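/- For a group $G$, the intersection graph $\Gamma(G)$ has as vertices the proper non-trivial subgroups of $G$, two distinct vertices $H,K$ being adjacent if and only if $H\cap K\neq\{e\}$. A set $W$ of vertices of a finite connected graph $\Gamma$ is resolving if distinct vertices of $\Gamma$ have distinct vectors of distances to the elements of $W$; $\beta(\Gamma)$ is the least cardinality of a resolving set, $r_i$ is the number of resolving sets of cardinality $i$, and, when $\Gamma$ has order $n$, its resolving polynomial is $\beta(\Gamma,x)=\sum_{i=\beta(\Gamma)}^{n}r_ix^i$. **Theorem.** Let $p$ be a prime, let $D_{2p^2}$ be the dihedral group of order $2p^2$, and let $\Gamma=\Gamma(D_{2p^2})$. Then $\beta(\Gamma)=p^2-p+1$ and $$\beta(\Gamma,x)=x^{p^2-p+1}\Big(\tbinom{2}{1}\tbinom{p}{p-1}^p+\sum_{q=1}^{p}r_{p^2-p+1+q}\,x^q+\sum_{k=p+1}^{2p-1}r_{p^2-p+1+k}\,x^k+(p^2+p+2)\,x^{2p}+x^{2p+1}\Big),$$ where the remaining coefficients are as follows. For $1\le q\le p$, $$r_{p^2-p+1+q}=\tbinom{p}{q}\tbinom{p}{p-1}^{p-q}\tbinom21\tbinom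 p0+\sum_{i=1}^{q}\tbinom{p}{q-i}\tbinom{p}{p-1}^{p-(q-i)}\tbinom21\tbinom pi+\tbinom{p}{q-1}\tbinom{p}{p-1}^{p-(q-1)}\tbinom22\tbinom p0+\sum_{i=1}^{q-1}\tbinom{p}{q-1-i}\tbinom{p}{p-1}^{p-(q-1-i)}\tbinom22\tbinom pi .$$ For $p+1\le k\le 2p-1$, $$r_{p^2-p+1+k}=\sum_{(a,c,b)\in T_k}\tbinom{p}{a}\tbinom{p}{p-1}^{p-a}\tbinom{2}{c}\tbinom{p}{b},$$ where $T_k$ is the set (each element counted once) of all triples of one of the six forms $$(k_1,1,k_2),\ (k_2,1,k_1),\ (k_1-1,2,k_2),\ (k_1,2,k_2-1),\ (k_2-1,2,k_1),\ (k_2,2,k_1-1)$$ with integers $1\le k_1,k_2\le p$ and $k_1+k_2=k$. -/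

import Mathlib

open Polynomial

/-- The intersection graph of a group `G`: its vertices are the proper non-trivial subgroups of `G`,
and two distinct vertices are adjacent when their intersection is non-trivial. -/
def intersectionGraph (G : Type*) [Group G] :
    SimpleGraph {H : Subgroup G // H ≠ ⊥ ∧ H ≠ ⊤} where
  Adj H K := H ≠ K ∧ H.1 ⊓ K.1 ≠ ⊥
  symm := ⟨fun H K h => ⟨h.1.symm, by rw [inf_comm]; exact h.2⟩⟩
  loopless := ⟨fun _ h => h.1 rfl⟩

namespace SimpleGraph

variable {V : Type*}

/-- `W` is a resolving set of the (connected) graph `Γ`: vertices with the same vector of distances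
to the elements of `W` are equal. -/
def IsResolvingSet (Γ : SimpleGraph V) (W : Finset V) : Prop :=
  ∀ u v : V, (∀ w ∈ W, Γ.dist u w = Γ.dist v w) → u = v

/-- The metric dimension of a finite graph: the least cardinality of a resolving set. -/
noncomputable def metricDimension (Γ : SimpleGraph V) : ℕ :=
  sInf {m : ℕ | ∃ W : Finset V, Γ.IsResolvingSet W ∧ W.card = m}

/-- The number `r_i` of resolving sets of cardinality `i` of a finite graph. -/
noncomputable def resolvingNumber (Γ : SimpleGraph V) (i : ℕ) : ℕ :=
  {W : Finset V | Γ.IsResolvingSet W ∧ W.card = i}.ncard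

/-- The resolving polynomial `∑ r_i x ^ i` of a finite graph, with `i` running from the metric
dimension to the order of the graph. -/
noncomputable def resolvingPolynomial (Γ : SimpleGraph V) : ℕ[X] :=
  ∑ i ∈ Finset.Icc Γ.metricDimension (Nat.card V), C (Γ.resolvingNumber i) * X ^ i

end SimpleGraph

/-- The product of binomial coefficients
`(p choose a) (p choose (p-1))^(p-a) (2 choose c) (p choose b)`. -/
def resolvingTerm (p a c b : ℕ) : ℕ :=
  p.choose a * p.choose (p - 1) ^ (p - a) * Nat.choose 2 c * p.choose b

/-- The set of triples `(a, c, b)` attached to a splitting `k = k₁ + k₂` with `k₁, k₂ ≥ 1`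
(six triples, some of which coincide when `k₁` and `k₂` differ by at most one). -/
def splittingTypes (k₁ k₂ : ℕ) : Finset (ℕ × ℕ × ℕ) :=
  {(k₁, 1, k₂), (k₂, 1, k₁), (k₁ - 1, 2, k₂), (k₁, 2, k₂ - 1), (k₂ - 1, 2, k₁), (k₂, 2, k₁ - 1)}

/-- The set of all triples attached to some splitting `k = k₁ + k₂` with `1 ≤ k₁, k₂ ≤ p`. -/
def resolvingTypes (p k : ℕ) : Finset (ℕ × ℕ × ℕ) :=
  ((Finset.Icc 1 p ×ˢ Finset.Icc 1 p).filter fun s => s.1 + s.2 = k).biUnion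
    fun s => splittingTypes s.1 s.2

/-!
The proper non-trivial subgroups of `D_{2p²}` are the rotation groups of orders `p` and `p²`, the
`p` dihedral subgroups of order `2p` and the `p²` subgroups of order two generated by a reflection.
The first `p + 2` of these all contain the rotations of order `p`, so they form a clique of the
intersection graph, whereas a subgroup generated by a reflection meets only the dihedral subgroup of
order `2p` containing it. The intersection graph is therefore a clique on `2 + p` vertices in which
each of `p` vertices carries `p` pendant vertices (`DihedralGroup.pendantCliqueIso`).

In such a graph the vertices without pendants are mutual twins, and so are the pendants at a fixed
vertex. A resolving set misses at most one vertex of each of these twin classes, and conversely this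
suffices, because all other pairs of vertices are separated by the chosen elements
(`SimpleGraph.isResolvingSet_pendantClique_iff`). The vertices carrying pendants may be chosen
freely. Each twin class of size `m` thus contributes the factor `x ^ (m - 1) * (m + x)` to the
generating function of the resolving sets, which for `D_{2p²}` is
`x ^ (p² - p + 1) * (2 + x) * (p + x) ^ p * (1 + x) ^ p` (`resolvingNumber_dihedral`).
All the formulas are read off from its coefficients.
-/

/-! ### Resolving sets, isomorphisms and twins -/

namespace SimpleGraph

variable {V V' : Type*}

theorem Iso.dist_map_le {G : SimpleGraph V} {G' : SimpleGraph V'} (e : G ≃g G') (u v : V)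
    (h : G.Reachable u v) : G'.dist (e u) (e v) ≤ G.dist u v := by
  obtain ⟨w, hw⟩ := h.exists_walk_length_eq_dist
  rw [← hw, ← Walk.length_map e.toHom w]
  exact dist_le _

theorem Iso.dist_map {G : SimpleGraph V} {G' : SimpleGraph V'} (e : G ≃g G') (u v : V) :
    G'.dist (e u) (e v) = G.dist u v := by
  by_cases h : G.Reachable u v
  · refine le_antisymm (e.dist_map_le u v h) ?_
    simpa using e.symm.dist_map_le (e u) (e v) (e.reachable_iff.2 h)
  · rw [dist_eq_zero_of_not_reachable h,
      dist_eq_zero_of_not_reachable (mt e.reachable_iff.1 h)]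

theorem Iso.isResolvingSet_map {G : SimpleGraph V} {G' : SimpleGraph V'} (e : G ≃g G')
    (W : Finset V) : G'.IsResolvingSet (W.map e.toEquiv.toEmbedding) ↔ G.IsResolvingSet W := by
  constructor
  · intro h u v huv
    apply e.injective
    apply h
    intro w hw
    obtain ⟨x, hx, rfl⟩ := Finset.mem_map.1 hw
    exact ((e.dist_map u x).trans (huv x hx)).trans (e.dist_map v x).symm
  · intro h u v huv
    apply e.symm.injective
    apply h
    intro w hw
    have := huv (e w) (Finset.mem_map_of_mem _ hw)
    rw [← e.dist_map, ← e.dist_map]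
    simpa using this

theorem Iso.resolvingNumber_eq {G : SimpleGraph V} {G' : SimpleGraph V'} (e : G ≃g G') (i : ℕ) :
    G.resolvingNumber i = G'.resolvingNumber i := by
  refine Set.ncard_congr (fun W _ => W.map e.toEquiv.toEmbedding) ?_ ?_ ?_
  · rintro W ⟨h, rfl⟩
    exact ⟨(e.isResolvingSet_map W).2 h, Finset.card_map _⟩
  · intro W W' _ _ h
    exact Finset.map_injective _ h
  · rintro W ⟨h, rfl⟩
    refine ⟨W.map e.symm.toEquiv.toEmbedding,
      ⟨(e.symm.isResolvingSet_map W).2 h, Finset.card_map _⟩, ?_⟩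
    rw [Finset.map_map]
    convert Finset.map_refl
    ext x
    exact e.apply_symm_apply x

theorem metricDimension_eq_sInf_resolvingNumber [Finite V] (G : SimpleGraph V) :
    G.metricDimension = sInf {m | G.resolvingNumber m ≠ 0} := by
  have : Finite (Finset V) := inferInstance
  unfold metricDimension resolvingNumber
  congr 1
  ext m
  simp only [Set.mem_ofPred_eq, ne_eq]
  rw [Set.ncard_eq_zero (Set.toFinite _), ← ne_eq, ← Set.nonempty_iff_ne_empty]
  rfl

/-- Two twins, i.e. vertices with the same neighbours apart from themselves, are exchanged by a
graph automorphism fixing all other vertices. -/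
theorem dist_eq_of_twins {G : SimpleGraph V} {u v w : V}
    (h : ∀ x, x ≠ u → x ≠ v → (G.Adj u x ↔ G.Adj v x)) (hu : w ≠ u) (hv : w ≠ v) :
    G.dist u w = G.dist v w := by
  classical
  let e : G ≃g G :=
    { Equiv.swap u v with
      map_rel_iff' := by
        intro a b
        have hs := G.adj_comm
        have hl := fun x => G.irrefl (v := x)
        simp only [Equiv.swap_apply_def]
        grind }
  have := e.dist_map u w
  have h1 : e u = v := Equiv.swap_apply_left u v
  have h2 : e w = w := Equiv.swap_apply_of_ne_of_ne hu hv
  rw [← this, h1, h2]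

/-- A resolving set misses at most one of two twins. -/
theorem IsResolvingSet.mem_or_mem_of_twins {G : SimpleGraph V} {W : Finset V}
    (hW : G.IsResolvingSet W) {u v : V} (huv : u ≠ v)
    (h : ∀ x, x ≠ u → x ≠ v → (G.Adj u x ↔ G.Adj v x)) : u ∈ W ∨ v ∈ W := by
  by_contra! hn
  refine huv (hW u v fun w hw => dist_eq_of_twins h ?_ ?_)
  · rintro rfl; exact hn.1 hw
  · rintro rfl; exact hn.2 hw

/-! ### Cliques with pendant vertices -/

/-- The graph obtained from the complete graph on `α ⊕ ι` by attaching to each vertex `j : ι` a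
family of pendant vertices indexed by `κ j`. -/
def pendantClique (α ι : Type*) (κ : ι → Type*) : SimpleGraph (α ⊕ ι ⊕ (Σ j, κ j)) where
  Adj
    | .inl a, .inl b => a ≠ b
    | .inl _, .inr (.inl _) => True
    | .inl _, .inr (.inr _) => False
    | .inr (.inl _), .inl _ => True
    | .inr (.inl i), .inr (.inl j) => i ≠ j
    | .inr (.inl i), .inr (.inr m) => m.1 = i
    | .inr (.inr _), .inl _ => False
    | .inr (.inr m), .inr (.inl i) => m.1 = i
    | .inr (.inr _), .inr (.inr _) => False
  symm := ⟨by rintro (a | i | m) (b | j | n) h <;> first | exact h | exact Ne.symm h⟩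
  loopless := ⟨by rintro (a | i | m) h <;> first | exact h | exact h rfl⟩

section PendantClique

variable {α ι : Type*} {κ : ι → Type*}

theorem dist_pendant_eq_two {j : ι} {m n : κ j} (h : m ≠ n) :
    (pendantClique α ι κ).dist (.inr (.inr ⟨j, m⟩)) (.inr (.inr ⟨j, n⟩)) = 2 := by
  have h1 : (pendantClique α ι κ).Adj (.inr (.inr ⟨j, m⟩)) (.inr (.inl j)) := rfl
  have h2 : (pendantClique α ι κ).Adj (.inr (.inl j)) (.inr (.inr ⟨j, n⟩)) := rfl
  have hle := dist_le (Walk.cons h1 (Walk.cons h2 Walk.nil))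
  simp only [Walk.length_cons, Walk.length_nil] at hle
  have h0 := (h1.reachable.trans h2.reachable).dist_eq_zero_iff.not.2 (by simpa using h)
  have h1' := dist_eq_one_iff_adj (G := pendantClique α ι κ) (u := .inr (.inr ⟨j, m⟩))
    (v := .inr (.inr ⟨j, n⟩)) |>.not.2 (fun h => h)
  omega

/-- Pendants at different vertices have no common neighbour. -/
theorem dist_pendant_ne_two {i j : ι} (h : i ≠ j) (m : κ i) (n : κ j) :
    (pendantClique α ι κ).dist (.inr (.inr ⟨i, m⟩)) (.inr (.inr ⟨j, n⟩)) ≠ 2 := by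
  intro hd
  obtain ⟨w, hw⟩ := exists_walk_of_dist_ne_zero (hd ▸ two_ne_zero)
  rw [hd] at hw
  cases w with
  | nil => exact h rfl
  | @cons _ x _ h1 w =>
    cases w with
    | nil => simp at hw
    | cons h2 w =>
      simp only [Walk.length_cons] at hw
      cases Walk.eq_of_length_eq_zero (p := w) (by omega)
      rcases x with a | k | x
      · exact h1
      · exact h (Eq.trans (b := k) h1 (Eq.symm h2))
      · exact h1

/-- The twin classes of `pendantClique α ι κ` are `α` and the families `κ j`; when all of them have
at least two elements, a set is resolving iff it misses at most one element of each. -/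
theorem isResolvingSet_pendantClique_iff [Nontrivial α] [∀ j, Nontrivial (κ j)]
    (W : Finset (α ⊕ ι ⊕ (Σ j, κ j))) :
    (pendantClique α ι κ).IsResolvingSet W ↔
      (∀ a b : α, .inl a ∉ W → .inl b ∉ W → a = b) ∧
      ∀ j, ∀ m n : κ j, .inr (.inr ⟨j, m⟩) ∉ W → .inr (.inr ⟨j, n⟩) ∉ W → m = n := by
  constructor
  · intro hW
    constructor
    · intro a b ha hb
      by_contra hab
      refine (hW.mem_or_mem_of_twins (u := .inl a) (v := .inl b) (by simpa using hab) ?_).elim ha hb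
      rintro (c | i | m) hc hc'
      · have h1 : a ≠ c := by rintro rfl; exact hc rfl
        have h2 : b ≠ c := by rintro rfl; exact hc' rfl
        exact iff_of_true h1 h2
      · exact Iff.rfl
      · exact Iff.rfl
    · intro j m n hm hn
      by_contra hmn
      refine (hW.mem_or_mem_of_twins (u := .inr (.inr ⟨j, m⟩)) (v := .inr (.inr ⟨j, n⟩))
        (by simpa using hmn) ?_).elim hm hn
      rintro (c | i | m) _ _ <;> exact Iff.rfl
  · rintro ⟨hα, hκ⟩ u v huv
    obtain ⟨a, ha⟩ : ∃ a : α, .inl a ∈ W := by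
      obtain ⟨a, b, hab⟩ := exists_pair_ne α
      by_contra! hn
      exact hab (hα a b (hn a) (hn b))
    have hpend : ∀ j, ∃ m : κ j, .inr (.inr ⟨j, m⟩) ∈ W := by
      intro j
      obtain ⟨m, n, hmn⟩ := exists_pair_ne (κ j)
      by_contra! hn
      exact hmn (hκ j m n (hn m) (hn n))
    have hconn : ∀ x y, (pendantClique α ι κ).Reachable x y := by
      have key : ∀ x, (pendantClique α ι κ).Reachable x (.inl a) := by
        have hι : ∀ i, (pendantClique α ι κ).Adj (.inr (.inl i)) (.inl a) := fun _ => trivial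
        rintro (b | i | m)
        · by_cases hb : b = a
          · subst hb; rfl
          · exact Adj.reachable (G := pendantClique α ι κ) (u := .inl b) (v := .inl a) hb
        · exact (hι i).reachable
        · have : (pendantClique α ι κ).Adj (.inr (.inr m)) (.inr (.inl m.1)) := rfl
          exact this.reachable.trans (hι m.1).reachable
      exact fun x y => (key x).trans (key y).symm
    -- A vertex lying in `W` is the only one at distance `0` from itself.
    by_cases huW : u ∈ W
    · have := huv u huW
      rw [dist_self, eq_comm, (hconn _ _).dist_eq_zero_iff] at this
      exact this.symm
    by_cases hvW : v ∈ W
    · have := huv v hvW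
      rwa [dist_self, (hconn _ _).dist_eq_zero_iff] at this
    have hadj : ∀ w ∈ W, ((pendantClique α ι κ).Adj u w ↔ (pendantClique α ι κ).Adj v w) := by
      intro w hw
      rw [← dist_eq_one_iff_adj, ← dist_eq_one_iff_adj, huv w hw]
    -- Neither `u` nor `v` lies in `W`. Adjacency to a chosen element of `α` or to a chosen pendant
    -- separates them unless both are in `α` or both are pendants.
    have hA := hadj _ ha
    rcases u with b | i | ⟨i, m⟩ <;> rcases v with c | j | ⟨j, n⟩
    · rw [hα b c huW hvW]
    · obtain ⟨m, hm⟩ := hpend j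
      exact ((hadj _ hm).2 rfl).elim
    · have hba : b ≠ a := by rintro rfl; exact huW ha
      exact (hA.1 hba).elim
    · obtain ⟨m, hm⟩ := hpend i
      exact ((hadj _ hm).1 rfl).elim
    · obtain ⟨m, hm⟩ := hpend i
      have hij : i = j := (hadj _ hm).1 rfl
      rw [hij]
    · exact (hA.1 trivial).elim
    · have hca : c ≠ a := by rintro rfl; exact hvW ha
      exact (hA.2 hca).elim
    · exact (hA.2 trivial).elim
    · by_cases hij : i = j
      · subst hij
        rw [hκ i m n huW hvW]
      · -- A chosen pendant at `i` has distance two from `⟨i, m⟩` but not from `⟨j, n⟩`.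
        obtain ⟨l, hl⟩ := hpend i
        have hml : m ≠ l := by rintro rfl; exact huW hl
        have := huv _ hl
        rw [dist_pendant_eq_two hml] at this
        exact (dist_pendant_ne_two (Ne.symm hij) n l this.symm).elim

end PendantClique

end SimpleGraph

/-! ### Subgroups of the dihedral group of order `2p²` -/

namespace DihedralGroup

section Subgroups

variable {n : ℕ}

/-- The rotations `r i` with `i ∈ K`. -/
def rotations (K : AddSubgroup (ZMod n)) : Subgroup (DihedralGroup n) where
  carrier := {x | match x with
    | r i => i ∈ K
    | sr _ => False}
  one_mem' := K.zero_mem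
  mul_mem' := by
    rintro (i | i) (j | j) hi hj
    · exact K.add_mem hi hj
    · exact hj
    · exact hi
    · exact hi.elim
  inv_mem' := by
    rintro (i | i) hi
    · exact K.neg_mem hi
    · exact hi

/-- The rotations `r i` with `i ∈ K` together with the reflections `sr i` with `i ∈ c + K`. -/
def dihedral (K : AddSubgroup (ZMod n)) (c : ZMod n) : Subgroup (DihedralGroup n) where
  carrier := {x | match x with
    | r i => i ∈ K
    | sr i => i - c ∈ K}
  one_mem' := K.zero_mem
  mul_mem' := by
    rintro (i | i) (j | j) hi hj
    · exact K.add_mem hi hj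
    · change j - i - c ∈ K
      rw [sub_right_comm]
      exact K.sub_mem hj hi
    · change i + j - c ∈ K
      rw [add_sub_right_comm]
      exact K.add_mem hi hj
    · change j - i ∈ K
      rw [← sub_sub_sub_cancel_right j i c]
      exact K.sub_mem hj hi
  inv_mem' := by
    rintro (i | i) hi
    · exact K.neg_mem hi
    · exact hi

@[simp] theorem r_mem_rotations {K : AddSubgroup (ZMod n)} {i : ZMod n} :
    r i ∈ rotations K ↔ i ∈ K := Iff.rfl

@[simp] theorem sr_mem_rotations {K : AddSubgroup (ZMod n)} {i : ZMod n} :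
    sr i ∈ rotations K ↔ False := Iff.rfl

@[simp] theorem r_mem_dihedral {K : AddSubgroup (ZMod n)} {c i : ZMod n} :
    r i ∈ dihedral K c ↔ i ∈ K := Iff.rfl

@[simp] theorem sr_mem_dihedral {K : AddSubgroup (ZMod n)} {c i : ZMod n} :
    sr i ∈ dihedral K c ↔ i - c ∈ K := Iff.rfl

/-- A subgroup is determined by its rotations together with any one of its reflections. -/
theorem eq_rotations_or_eq_dihedral (H : Subgroup (DihedralGroup n)) :
    ∃ K : AddSubgroup (ZMod n), H = rotations K ∨ ∃ c, H = dihedral K c := by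
  let K : AddSubgroup (ZMod n) :=
    { carrier := {i | r i ∈ H}
      zero_mem' := H.one_mem
      add_mem' := fun {i j} hi hj => H.mul_mem (x := r i) (y := r j) hi hj
      neg_mem' := fun {i} hi => H.inv_mem (x := r i) hi }
  refine ⟨K, ?_⟩
  by_cases h : ∃ c, sr c ∈ H
  · obtain ⟨c, hc⟩ := h
    refine .inr ⟨c, ?_⟩
    ext (i | i)
    · exact Iff.rfl
    · rw [sr_mem_dihedral, ← H.mul_mem_cancel_left hc (y := sr i), sr_mul_sr]
      exact Iff.rfl
  · push Not at h
    refine .inl ?_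
    ext (i | i)
    · exact Iff.rfl
    · exact iff_of_false (h i) id

end Subgroups

section PrimeSq

variable (p : ℕ)

/-- Reduction modulo `p` on `ℤ/p²ℤ`. -/
def reduce : ZMod (p ^ 2) →+* ZMod p := ZMod.castHom (dvd_pow_self p two_ne_zero) (ZMod p)

theorem reduce_surjective : Function.Surjective (reduce p) := ZMod.castHom_surjective _

variable [hp : Fact p.Prime]

variable {p} in
theorem reduce_eq_zero_iff {x : ZMod (p ^ 2)} : reduce p x = 0 ↔ p ∣ x.val := by
  rw [← ZMod.natCast_eq_zero_iff, ← map_natCast (reduce p), ZMod.natCast_zmod_val]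

theorem exists_ne_zero_reduce_eq_zero : ∃ i : ZMod (p ^ 2), i ≠ 0 ∧ reduce p i = 0 := by
  refine ⟨(p : ℕ), ?_, by simp⟩
  rw [Ne, ZMod.natCast_eq_zero_iff]
  intro h
  have := Nat.le_of_dvd hp.out.pos h
  have := hp.out.one_lt
  nlinarith

theorem card_fiber_reduce (j : ZMod p) : Nat.card {i : ZMod (p ^ 2) // reduce p i = j} = p := by
  have h : ∀ k, Nat.card {i : ZMod (p ^ 2) // reduce p i = k} =
      Nat.card {i : ZMod (p ^ 2) // reduce p i = j} := by
    intro k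
    obtain ⟨x, hx⟩ := reduce_surjective p (k - j)
    refine Nat.card_congr ((Equiv.subRight x).subtypeEquiv fun i => ?_)
    rw [Equiv.subRight_apply, map_sub, hx]
    constructor <;> intro h
    · rw [h]; ring
    · linear_combination h
  have hs := Nat.card_congr (Equiv.sigmaFiberEquiv (reduce p))
  rw [Nat.card_sigma, Finset.sum_congr rfl fun k _ => h k, Finset.sum_const, Nat.card_zmod,
    Finset.card_univ, ZMod.card, smul_eq_mul] at hs
  exact Nat.eq_of_mul_eq_mul_left hp.out.pos (hs.trans (sq p))

/-- The subgroups of `ℤ/p²ℤ` are ideals, and every element outside the kernel of the reduction is a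
unit; a non-zero element of the kernel is `p` times a unit, so it generates the kernel. -/
theorem addSubgroup_zmod_prime_sq (K : AddSubgroup (ZMod (p ^ 2))) :
    K = ⊥ ∨ K = (reduce p).toAddMonoidHom.ker ∨ K = ⊤ := by
  have hmul : ∀ z, ∀ x ∈ K, z * x ∈ K := by
    intro z x hx
    rw [← ZMod.natCast_zmod_val z, ← nsmul_eq_mul]
    exact K.nsmul_mem hx _
  have hunit : ∀ m : ℕ, ¬ p ∣ m → IsUnit (m : ZMod (p ^ 2)) := by
    intro m hm
    rw [ZMod.isUnit_iff_coprime]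
    exact (((hp.out.coprime_iff_not_dvd).2 hm).symm).pow_right 2
  by_cases h : ∀ x ∈ K, reduce p x = 0
  · by_cases h0 : K = ⊥
    · exact .inl h0
    refine .inr (.inl (le_antisymm (fun x hx => h x hx) ?_))
    obtain ⟨x, hxK, hx0⟩ := K.bot_or_exists_ne_zero.resolve_left h0
    obtain ⟨m, hm⟩ := reduce_eq_zero_iff.1 (h x hxK)
    have hx : x = m * p := by
      rw [← ZMod.natCast_zmod_val x, hm]; push_cast; ring
    have hpm : ¬ p ∣ m := by
      rintro ⟨l, rfl⟩
      apply hx0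
      rw [← ZMod.natCast_zmod_val x, hm, ZMod.natCast_eq_zero_iff]
      exact ⟨l, by ring⟩
    obtain ⟨u, hu⟩ := hunit m hpm
    have hpK : (p : ZMod (p ^ 2)) ∈ K := by
      have := hmul (↑u⁻¹) x hxK
      rwa [hx, ← hu, Units.inv_mul_cancel_left] at this
    intro y hy
    obtain ⟨l, hl⟩ := reduce_eq_zero_iff.1 (show reduce p y = 0 from hy)
    rw [← ZMod.natCast_zmod_val y, hl, Nat.cast_mul, mul_comm]
    exact hmul _ _ hpK
  · push Not at h
    obtain ⟨x, hxK, hx⟩ := h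
    obtain ⟨u, hu⟩ := hunit x.val (mt reduce_eq_zero_iff.2 hx)
    rw [ZMod.natCast_zmod_val] at hu
    refine .inr (.inr (eq_top_iff.2 fun y _ => ?_))
    have := hmul (y * ↑u⁻¹) x hxK
    rwa [← hu, Units.inv_mul_cancel_right] at this

/-- The proper non-trivial subgroups of the dihedral group of order `2p²`: the rotation groups of
order `p²` (for `true`) and `p` (for `false`), the dihedral groups of order `2p`, one for each
residue `j` modulo `p`, and the groups generated by a reflection `sr i`, sorted by the residue of
`i` modulo `p`. -/
noncomputable def subgroupOfIndex :
    Bool ⊕ ZMod p ⊕ (Σ j, {i : ZMod (p ^ 2) // reduce p i = j}) → Subgroup (DihedralGroup (p ^ 2))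
  | .inl true => rotations ⊤
  | .inl false => rotations (reduce p).toAddMonoidHom.ker
  | .inr (.inl j) =>
      dihedral (reduce p).toAddMonoidHom.ker (Function.surjInv (reduce_surjective p) j)
  | .inr (.inr m) => dihedral ⊥ m.2

theorem r_mem_subgroupOfIndex {x i} : r i ∈ subgroupOfIndex p x ↔ match x with
    | .inl true => True
    | .inl false | .inr (.inl _) => reduce p i = 0
    | .inr (.inr _) => i = 0 := by
  rcases x with (_ | _) | _ | _ <;> exact Iff.rfl

theorem sr_mem_subgroupOfIndex {x i} : sr i ∈ subgroupOfIndex p x ↔ match x with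
    | .inl _ => False
    | .inr (.inl j) => reduce p i = j
    | .inr (.inr m) => i = m.2 := by
  rcases x with (_ | _) | j | m
  · exact Iff.rfl
  · exact Iff.rfl
  · change reduce p (i - _) = 0 ↔ reduce p i = j
    rw [map_sub, Function.surjInv_eq (reduce_surjective p), sub_eq_zero]
  · exact sub_eq_zero

theorem subgroupOfIndex_injective : Function.Injective (subgroupOfIndex p) := by
  obtain ⟨i₀, hi₀, hi₀'⟩ := exists_ne_zero_reduce_eq_zero p
  intro x y hxy
  have hr : ∀ i, r i ∈ subgroupOfIndex p x ↔ r i ∈ subgroupOfIndex p y := by simp [hxy]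
  have hs : ∀ i, sr i ∈ subgroupOfIndex p x ↔ sr i ∈ subgroupOfIndex p y := by simp [hxy]
  have h0 := hr i₀
  have h1 := hr 1
  have hsurj := reduce_surjective p
  simp only [r_mem_subgroupOfIndex] at h0 h1
  simp only [sr_mem_subgroupOfIndex] at hs
  clear hxy hr
  rcases x with (_ | _) | j | ⟨_, m, rfl⟩ <;> rcases y with (_ | _) | k | ⟨_, n, rfl⟩ <;>
    simp only [hi₀, hi₀', map_one, one_ne_zero, iff_true, iff_false, false_iff,
      not_true_eq_false] at h0 h1 hs ⊢
  · obtain ⟨i, hi⟩ := hsurj k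
    exact (hs i hi).elim
  · obtain ⟨i, hi⟩ := hsurj j
    exact (hs i hi).elim
  · obtain ⟨i, hi⟩ := hsurj j
    rw [hi.symm.trans ((hs i).1 hi)]
  · cases (hs m).1 rfl
    rfl

theorem subgroupOfIndex_ne_bot (x) : subgroupOfIndex p x ≠ ⊥ := by
  obtain ⟨i₀, hi₀, hi₀'⟩ := exists_ne_zero_reduce_eq_zero p
  intro h
  have hr := r_mem_subgroupOfIndex p (x := x) (i := i₀)
  have hs := fun i => sr_mem_subgroupOfIndex p (x := x) (i := i)
  rw [h, Subgroup.mem_bot, ← r_zero, r.injEq] at hr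
  simp only [h, Subgroup.mem_bot, ← r_zero, reduceCtorEq] at hs
  rcases x with (_ | _) | j | ⟨_, m, rfl⟩
  · exact hi₀ (hr.2 hi₀')
  · exact hi₀ (hr.2 trivial)
  · exact hi₀ (hr.2 hi₀')
  · exact (hs m).2 rfl

theorem subgroupOfIndex_ne_top (x) : subgroupOfIndex p x ≠ ⊤ := by
  intro h
  have hr := r_mem_subgroupOfIndex p (x := x) (i := 1)
  have hs := sr_mem_subgroupOfIndex p (x := x) (i := 0)
  rw [h] at hr hs
  simp only [Subgroup.mem_top, true_iff] at hr hs
  have : Fact (1 < p ^ 2) := ⟨Nat.one_lt_pow two_ne_zero hp.out.one_lt⟩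
  have h10 : (1 : ZMod (p ^ 2)) ≠ 0 := one_ne_zero
  clear h
  rcases x with (_ | _) | j | ⟨_, m, rfl⟩ <;> simp_all

theorem exists_subgroupOfIndex_eq {H : Subgroup (DihedralGroup (p ^ 2))} (h₀ : H ≠ ⊥)
    (h₁ : H ≠ ⊤) : ∃ x, subgroupOfIndex p x = H := by
  obtain ⟨K, rfl | ⟨c, rfl⟩⟩ := eq_rotations_or_eq_dihedral H <;>
    rcases addSubgroup_zmod_prime_sq p K with rfl | rfl | rfl
  · refine (h₀ ?_).elim
    ext (i | i)
    · rw [Subgroup.mem_bot, ← r_zero, r.injEq]; exact Iff.rfl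
    · rw [Subgroup.mem_bot, ← r_zero]; exact iff_of_false id nofun
  · exact ⟨.inl false, rfl⟩
  · exact ⟨.inl true, rfl⟩
  · exact ⟨.inr (.inr ⟨reduce p c, c, rfl⟩), rfl⟩
  · refine ⟨.inr (.inl (reduce p c)), ?_⟩
    ext (i | i)
    · exact Iff.rfl
    · rw [sr_mem_subgroupOfIndex, sr_mem_dihedral, AddMonoidHom.mem_ker]
      simp [sub_eq_zero]
  · refine (h₁ ?_).elim
    ext (i | i) <;> simp

open SimpleGraph in
/-- The intersection graph of the dihedral group of order `2p²`: the `p + 2` subgroups containing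
the rotation group of order `p` form a clique, and a reflection generates a group whose only
neighbour is the dihedral group of order `2p` that contains the reflection. -/
noncomputable def pendantCliqueIso :
    pendantClique Bool (ZMod p) (fun j => {i : ZMod (p ^ 2) // reduce p i = j}) ≃g
      intersectionGraph (DihedralGroup (p ^ 2)) where
  toEquiv := Equiv.ofBijective
    (fun x => ⟨subgroupOfIndex p x, subgroupOfIndex_ne_bot p x, subgroupOfIndex_ne_top p x⟩)
    ⟨fun x y h => subgroupOfIndex_injective p (congrArg Subtype.val h), fun H =>
      (exists_subgroupOfIndex_eq p H.2.1 H.2.2).imp fun _ h => Subtype.ext h⟩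
  map_rel_iff' := by
    obtain ⟨i₀, hi₀, hi₀'⟩ := exists_ne_zero_reduce_eq_zero p
    intro x y
    have hne : subgroupOfIndex p x ⊓ subgroupOfIndex p y ≠ ⊥ ↔
        (∃ i, i ≠ 0 ∧ r i ∈ subgroupOfIndex p x ∧ r i ∈ subgroupOfIndex p y) ∨
          ∃ i, sr i ∈ subgroupOfIndex p x ∧ sr i ∈ subgroupOfIndex p y := by
      rw [Ne, Subgroup.eq_bot_iff_forall]
      push Not
      constructor
      · rintro ⟨i | i, hi, hi'⟩
        · exact .inl ⟨i, fun h => hi' (by rw [h, r_zero]), hi⟩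
        · exact .inr ⟨i, hi⟩
      · rintro (⟨i, hi', hi⟩ | ⟨i, hi⟩)
        · exact ⟨r i, hi, fun h => hi' (r.inj h)⟩
        · exact ⟨sr i, hi, nofun⟩
    change _ ≠ _ ∧ subgroupOfIndex p x ⊓ subgroupOfIndex p y ≠ ⊥ ↔ _
    rw [hne, (Equiv.injective _).ne_iff]
    clear hne
    simp only [r_mem_subgroupOfIndex, sr_mem_subgroupOfIndex]
    rcases x with (_ | _) | j | ⟨_, m, rfl⟩ <;> rcases y with (_ | _) | k | ⟨_, n, rfl⟩ <;>
      simp [pendantClique] <;> try grind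
    rintro h rfl
    exact h rfl HEq.rfl

end PrimeSq

end DihedralGroup

/-! ### Generating function of the resolving sets -/

open Finset in
/-- The generating function of the subsets of `β` that miss at most one element. -/
theorem sum_X_pow_card_of_card_le_succ (β : Type*) [Fintype β] [Nonempty β] :
    ∑ S : Finset β with Fintype.card β ≤ #S + 1, (X : ℕ[X]) ^ #S =
      X ^ (Fintype.card β - 1) * (C (Fintype.card β) + X) := by
  obtain ⟨n, hn⟩ : ∃ n, Fintype.card β = n + 1 :=
    Nat.exists_eq_succ_of_ne_zero Fintype.card_ne_zero
  rw [Finset.sum_filter, ← Finset.powerset_univ,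
    Finset.sum_powerset_apply_card (fun m => if Fintype.card β ≤ m + 1 then (X : ℕ[X]) ^ m else 0),
    Finset.card_univ, hn, Finset.sum_range_succ, Finset.sum_range_succ, Finset.sum_eq_zero]
  · rw [if_pos le_rfl, if_pos (Nat.le_succ _), Nat.choose_self, Nat.choose_succ_self_right,
      Nat.add_sub_cancel, one_smul, nsmul_eq_mul, ← C_eq_natCast, Nat.cast_id]
    ring
  · intro m hm
    rw [if_neg (by rw [Finset.mem_range] at hm; omega), smul_zero]

open Finset in
theorem card_le_card_add_one_iff {β : Type*} [Fintype β] (S : Finset β) :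
    Fintype.card β ≤ #S + 1 ↔ ∀ a b : β, a ∉ S → b ∉ S → a = b := by
  classical
  rw [← Finset.card_add_card_compl S, add_le_add_iff_left, Finset.card_le_one]
  simp only [Finset.mem_compl]
  exact ⟨fun h a b ha hb => h a ha b hb, fun h a ha b hb => h a b ha hb⟩

namespace SimpleGraph

open Finset

variable {V α ι : Type*} {κ : ι → Type*}

theorem resolvingNumber_eq_coeff [Fintype V] (G : SimpleGraph V)
    [DecidablePred G.IsResolvingSet] (i : ℕ) :
    G.resolvingNumber i =
      (∑ W : Finset V with G.IsResolvingSet W, (X : ℕ[X]) ^ #W).coeff i := by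
  rw [finsetSum_coeff]
  simp only [coeff_X_pow]
  rw [Finset.sum_boole, Nat.cast_id, Finset.filter_filter, resolvingNumber,
    ← Set.ncard_coe_finset]
  congr 1
  ext W
  simp [eq_comm]

/-- A subset of a disjoint union amounts to a subset of each part. -/
noncomputable def sumSigmaFinsetEquiv [Fintype ι] :
    Finset α × Finset ι × (∀ j, Finset (κ j)) ≃ Finset (α ⊕ ι ⊕ (Σ j, κ j)) where
  toFun S := S.1.disjSum (S.2.1.disjSum (univ.sigma S.2.2))
  invFun W := (W.toLeft, W.toRight.toLeft,
    fun j => W.toRight.toRight.preimage (Sigma.mk j) sigma_mk_injective.injOn)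
  left_inv := by
    rintro ⟨A, D, S⟩
    simp only [Finset.toLeft_disjSum, Finset.toRight_disjSum, Prod.mk.injEq, true_and]
    ext j m
    simp
  right_inv W := by
    ext (a | i | m) <;> simp

/-- The generating function of the resolving sets of `pendantClique α ι κ`: all but at most one
element of `α` and of each family `κ j` have to be chosen, and the elements of `ι` are free. -/
theorem sum_X_pow_card_resolving_pendantClique [Fintype α] [Nontrivial α] [Fintype ι]
    [DecidableEq ι]
    [∀ j, Fintype (κ j)] [∀ j, Nontrivial (κ j)]
    [DecidablePred (pendantClique α ι κ).IsResolvingSet] :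
    ∑ W : Finset (α ⊕ ι ⊕ (Σ j, κ j)) with (pendantClique α ι κ).IsResolvingSet W,
        (X : ℕ[X]) ^ #W =
      X ^ (Fintype.card α - 1) * (C (Fintype.card α) + X) * (X + 1) ^ Fintype.card ι *
        ∏ j, X ^ (Fintype.card (κ j) - 1) * (C (Fintype.card (κ j)) + X) := by
  classical
  have hι : (X + 1 : ℕ[X]) ^ Fintype.card ι = ∑ D : Finset ι, X ^ #D := by
    simp [← Fintype.sum_pow_mul_eq_add_pow]
  rw [← sum_X_pow_card_of_card_le_succ α, hι,
    Finset.prod_congr rfl fun j _ => (sum_X_pow_card_of_card_le_succ (κ j)).symm,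
    Finset.prod_univ_sum, mul_assoc, Finset.sum_mul_sum, ← Finset.sum_product',
    Finset.sum_mul_sum, ← Finset.sum_product']
  symm
  refine Finset.sum_bij (fun S _ => sumSigmaFinsetEquiv S) ?_
    (fun _ _ _ _ h => sumSigmaFinsetEquiv.injective h) ?_ ?_
  · rintro ⟨A, D, S⟩ h
    simpa [isResolvingSet_pendantClique_iff, sumSigmaFinsetEquiv,
      card_le_card_add_one_iff] using h
  · intro W hW
    obtain ⟨⟨A, D, S⟩, rfl⟩ := sumSigmaFinsetEquiv.surjective W
    refine ⟨(A, D, S), ?_, rfl⟩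
    simpa [isResolvingSet_pendantClique_iff, sumSigmaFinsetEquiv,
      card_le_card_add_one_iff] using hW
  · rintro ⟨A, D, S⟩ _
    simp [sumSigmaFinsetEquiv, pow_add, Finset.prod_pow_eq_pow_sum]

end SimpleGraph

open SimpleGraph DihedralGroup

/-- The coefficient of `x ^ q` in `(p + x) ^ p * (x + 1) ^ p`. -/
def pendantCoeff (p q : ℕ) : ℕ :=
  ∑ s ∈ Finset.HasAntidiagonal.antidiagonal q, p.choose s.1 * p ^ (p - s.1) * p.choose s.2

theorem pendantCoeff_eq_coeff (p q : ℕ) :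
    pendantCoeff p q = ((C p + X) ^ p * (X + 1) ^ p : ℕ[X]).coeff q := by
  rw [coeff_mul, pendantCoeff]
  refine Finset.sum_congr rfl fun s _ => ?_
  rw [coeff_X_add_one_pow, add_comm, coeff_X_add_C_pow]
  simp only [Nat.cast_id]
  ring

section

variable (p : ℕ) [Fact p.Prime]

/-- The generating function of the resolving sets of the intersection graph of the dihedral group of
order `2p²`. -/
theorem resolvingNumber_dihedral (i : ℕ) :
    (intersectionGraph (DihedralGroup (p ^ 2))).resolvingNumber i =
      (X ^ (p ^ 2 - p + 1) * ((C 2 + X) * ((C p + X) ^ p * (X + 1) ^ p)) : ℕ[X]).coeff i := by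
  classical
  have hp : p.Prime := Fact.out
  have hcard (j : ZMod p) : Fintype.card {i : ZMod (p ^ 2) // reduce p i = j} = p := by
    rw [← Nat.card_eq_fintype_card, card_fiber_reduce]
  have (j : ZMod p) : Nontrivial {i : ZMod (p ^ 2) // reduce p i = j} := by
    rw [← Fintype.one_lt_card_iff_nontrivial, hcard]
    exact hp.one_lt
  rw [← (pendantCliqueIso p).resolvingNumber_eq, resolvingNumber_eq_coeff,
    sum_X_pow_card_resolving_pendantClique]
  simp only [hcard, Finset.prod_const, Finset.card_univ, ZMod.card, Fintype.card_bool]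
  -- The factor `x ^ (2 - 1)` comes from the two rotation groups, `x ^ (p - 1)` from each of the `p`
  -- classes of reflections.
  have h : p ^ 2 - p + 1 = (2 - 1) + (p - 1) * p := by
    rw [Nat.sub_mul, sq, one_mul, add_comm]
  rw [h, pow_add, pow_mul, mul_pow]
  congr 1
  ring

theorem resolvingNumber_dihedral_of_lt {i : ℕ} (hi : i < p ^ 2 - p + 1) :
    (intersectionGraph (DihedralGroup (p ^ 2))).resolvingNumber i = 0 := by
  rw [resolvingNumber_dihedral, coeff_X_pow_mul', if_neg (by omega)]

theorem resolvingNumber_dihedral_zero :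
    (intersectionGraph (DihedralGroup (p ^ 2))).resolvingNumber (p ^ 2 - p + 1) =
      2 * pendantCoeff p 0 := by
  rw [resolvingNumber_dihedral, coeff_X_pow_mul', if_pos le_rfl, Nat.sub_self, add_mul, coeff_add,
    coeff_C_mul, coeff_X_mul_zero, pendantCoeff_eq_coeff, add_zero]

theorem resolvingNumber_dihedral_succ (q : ℕ) :
    (intersectionGraph (DihedralGroup (p ^ 2))).resolvingNumber (p ^ 2 - p + 1 + (q + 1)) =
      2 * pendantCoeff p (q + 1) + pendantCoeff p q := by
  rw [resolvingNumber_dihedral, coeff_X_pow_mul', if_pos (by omega), Nat.add_sub_cancel_left,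
    add_mul, coeff_add, coeff_C_mul, coeff_X_mul, pendantCoeff_eq_coeff, pendantCoeff_eq_coeff]

end

/-! ### Coefficients of the resolving polynomial -/

theorem pendantCoeff_zero (p : ℕ) : pendantCoeff p 0 = p ^ p := by
  simp [pendantCoeff]

theorem pendantCoeff_eq_add_sum (p q : ℕ) :
    pendantCoeff p q = p.choose q * p ^ (p - q) * p.choose 0 +
      ∑ i ∈ Finset.Icc 1 q, p.choose (q - i) * p ^ (p - (q - i)) * p.choose i := by
  rw [pendantCoeff, ← Finset.Nat.sum_antidiagonal_swap,
    Finset.Nat.sum_antidiagonal_eq_sum_range_succ_mk, Finset.range_eq_Ico,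
    Finset.sum_eq_sum_Ico_succ_bot (Nat.succ_pos q)]
  rfl

theorem choose_mul_pow_mul_choose_eq_zero {p a b : ℕ} (h : p < a ∨ p < b) :
    p.choose a * p ^ (p - a) * p.choose b = 0 := by
  rcases h with h | h <;> simp [Nat.choose_eq_zero_of_lt h]

theorem pendantCoeff_two_mul_add_one (p : ℕ) : pendantCoeff p (2 * p + 1) = 0 := by
  refine Finset.sum_eq_zero fun s hs => choose_mul_pow_mul_choose_eq_zero ?_
  rw [Finset.HasAntidiagonal.mem_antidiagonal] at hs
  omega

theorem pendantCoeff_two_mul (p : ℕ) : pendantCoeff p (2 * p) = 1 := by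
  rw [pendantCoeff, Finset.sum_eq_single (p, p)]
  · simp
  · rintro ⟨a, b⟩ hs hne
    rw [Finset.HasAntidiagonal.mem_antidiagonal] at hs
    rw [Ne, Prod.mk.injEq] at hne
    exact choose_mul_pow_mul_choose_eq_zero (by grind)
  · intro h
    exact (h (by simp [two_mul])).elim

theorem pendantCoeff_two_mul_sub_one {p : ℕ} (hp : 0 < p) :
    pendantCoeff p (2 * p - 1) = p ^ 2 + p := by
  rw [pendantCoeff, ← Finset.sum_subset (s₁ := {(p - 1, p), (p, p - 1)})]
  · rw [Finset.sum_pair (by grind)]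
    obtain ⟨m, rfl⟩ := Nat.exists_eq_succ_of_ne_zero hp.ne'
    simp [Nat.choose_succ_self_right]
    ring
  · intro s hs
    simp only [Finset.mem_insert, Finset.mem_singleton] at hs
    rw [Finset.HasAntidiagonal.mem_antidiagonal]
    grind
  · rintro ⟨a, b⟩ hs hne
    rw [Finset.HasAntidiagonal.mem_antidiagonal] at hs
    simp only [Finset.mem_insert, Finset.mem_singleton, Prod.mk.injEq] at hne
    exact choose_mul_pow_mul_choose_eq_zero (by grind)

theorem choose_pred_self {p : ℕ} (hp : 0 < p) : p.choose (p - 1) = p := by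
  obtain ⟨m, rfl⟩ := Nat.exists_eq_succ_of_ne_zero hp.ne'
  exact Nat.choose_succ_self_right m

theorem mem_resolvingTypes {p k : ℕ} {t : ℕ × ℕ × ℕ} : t ∈ resolvingTypes p k ↔
    ∃ k₁ k₂, 1 ≤ k₁ ∧ k₁ ≤ p ∧ 1 ≤ k₂ ∧ k₂ ≤ p ∧ k₁ + k₂ = k ∧ t ∈ splittingTypes k₁ k₂ := by
  simp [resolvingTypes, and_assoc]

/-- For `p < k < 2p`, the triples attached to the splittings of `k` are, up to triples with a
vanishing term, all `(a, c, b)` with `c ∈ {1, 2}` and `a + b + c = k + 1`. -/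
theorem sum_resolvingTypes {p k : ℕ} (h₁ : p ≤ k) (h₂ : k + 1 < 2 * p) :
    ∑ t ∈ resolvingTypes p (k + 1), resolvingTerm p t.1 t.2.1 t.2.2 =
      2 * pendantCoeff p (k + 1) + pendantCoeff p k := by
  have hp : 0 < p := by omega
  have himage (m c : ℕ) : ∑ t ∈ (Finset.HasAntidiagonal.antidiagonal m).image (fun s => (s.1, c, s.2)),
      resolvingTerm p t.1 t.2.1 t.2.2 = Nat.choose 2 c * pendantCoeff p m := by
    rw [Finset.sum_image fun s _ t _ h => by simp_all [Prod.ext_iff], pendantCoeff,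
      Finset.mul_sum]
    refine Finset.sum_congr rfl fun s _ => ?_
    rw [resolvingTerm, choose_pred_self hp]
    ring
  have hdisj : Disjoint ((Finset.HasAntidiagonal.antidiagonal (k + 1)).image fun s => (s.1, 1, s.2))
      ((Finset.HasAntidiagonal.antidiagonal k).image fun s => (s.1, 2, s.2)) := by
    rw [Finset.disjoint_left]
    intro t h h'
    obtain ⟨s, _, rfl⟩ := Finset.mem_image.1 h
    obtain ⟨s', _, h⟩ := Finset.mem_image.1 h'
    simp at h
  have hunion := Finset.sum_union hdisj (f := fun t => resolvingTerm p t.1 t.2.1 t.2.2)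
  rw [himage, himage, Nat.choose_self, one_mul, Nat.choose_one_right] at hunion
  rw [← hunion]
  refine Finset.sum_subset ?_ ?_
  · intro t ht
    obtain ⟨k₁, k₂, h1, h2, h3, h4, h5, ht⟩ := mem_resolvingTypes.1 ht
    simp only [splittingTypes, Finset.mem_insert, Finset.mem_singleton] at ht
    simp only [Finset.mem_union, Finset.mem_image, Finset.HasAntidiagonal.mem_antidiagonal, Prod.exists]
    rcases ht with rfl | rfl | rfl | rfl | rfl | rfl
    · exact .inl ⟨_, _, by omega, rfl⟩
    · exact .inl ⟨_, _, by omega, rfl⟩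
    all_goals exact .inr ⟨_, _, by omega, rfl⟩
  · intro t ht hnot
    have hzero {a c b : ℕ} (h : p < a ∨ p < b) : resolvingTerm p a c b = 0 := by
      rw [resolvingTerm]
      rcases h with h | h <;> simp [Nat.choose_eq_zero_of_lt h]
    simp only [Finset.mem_union, Finset.mem_image, Finset.HasAntidiagonal.mem_antidiagonal, Prod.exists] at ht
    rcases ht with ⟨a, b, hab, rfl⟩ | ⟨a, b, hab, rfl⟩ <;> apply hzero <;> by_contra! hle <;>
      change a ≤ p ∧ b ≤ p at hle <;>
      refine hnot (mem_resolvingTypes.2 ?_)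
    · exact ⟨a, b, by omega, by omega, by omega, by omega, hab, by simp [splittingTypes]⟩
    · -- For `a = p` the first entry cannot be raised, so `b` is raised instead; for `a < p` the
      -- condition `p ≤ k` forces `1 ≤ b`.
      by_cases hap : a = p
      · exact ⟨a, b + 1, by omega, by omega, by omega, by omega, by omega,
          by simp [splittingTypes]⟩
      · exact ⟨a + 1, b, by omega, by omega, by omega, by omega, by omega,
          by simp [splittingTypes]⟩

section

variable (p : ℕ) [Fact p.Prime]

theorem metricDimension_dihedral :
    (intersectionGraph (DihedralGroup (p ^ 2))).metricDimension = p ^ 2 - p + 1 := by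
  have hp : p.Prime := Fact.out
  have : NeZero (p ^ 2) := ⟨(pow_pos hp.pos 2).ne'⟩
  have hmem : p ^ 2 - p + 1 ∈
      {m | (intersectionGraph (DihedralGroup (p ^ 2))).resolvingNumber m ≠ 0} := by
    rw [Set.mem_ofPred_eq, resolvingNumber_dihedral_zero, pendantCoeff_zero]
    exact mul_ne_zero two_ne_zero (pow_pos hp.pos p).ne'
  rw [metricDimension_eq_sInf_resolvingNumber]
  refine le_antisymm (Nat.sInf_le hmem) (le_csInf ⟨_, hmem⟩ fun m hm => ?_)
  by_contra! hlt
  exact hm (resolvingNumber_dihedral_of_lt p hlt)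

theorem card_subgroups_dihedral :
    Nat.card {H : Subgroup (DihedralGroup (p ^ 2)) // H ≠ ⊥ ∧ H ≠ ⊤} = p ^ 2 + p + 2 := by
  have hp : p.Prime := Fact.out
  have : NeZero (p ^ 2) := ⟨(pow_pos hp.pos 2).ne'⟩
  rw [← Nat.card_congr (pendantCliqueIso p).toEquiv, Nat.card_sum, Nat.card_sum,
    Nat.card_congr (Equiv.sigmaFiberEquiv (reduce p)), Nat.card_zmod, Nat.card_zmod]
  simp
  ring

end

theorem mainTheorem2 (p : ℕ) (hp : p.Prime)
    (Γ : SimpleGraph {H : Subgroup (DihedralGroup (p ^ 2)) // H ≠ ⊥ ∧ H ≠ ⊤})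
    (hΓ : Γ = intersectionGraph (DihedralGroup (p ^ 2))) :
    Γ.metricDimension = p ^ 2 - p + 1 ∧
    Γ.resolvingPolynomial =
      X ^ (p ^ 2 - p + 1) *
        (C (Nat.choose 2 1 * p.choose (p - 1) ^ p)
          + ∑ q ∈ Finset.Icc 1 p, C (Γ.resolvingNumber (p ^ 2 - p + 1 + q)) * X ^ q
          + ∑ k ∈ Finset.Icc (p + 1) (2 * p - 1),
              C (Γ.resolvingNumber (p ^ 2 - p + 1 + k)) * X ^ k
          + C (p ^ 2 + p + 2) * X ^ (2 * p)
          + X ^ (2 * p + 1)) ∧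
    (∀ q ∈ Finset.Icc 1 p,
      Γ.resolvingNumber (p ^ 2 - p + 1 + q) =
        p.choose q * p.choose (p - 1) ^ (p - q) * Nat.choose 2 1 * p.choose 0
        + ∑ i ∈ Finset.Icc 1 q,
            p.choose (q - i) * p.choose (p - 1) ^ (p - (q - i)) * Nat.choose 2 1 * p.choose i
        + p.choose (q - 1) * p.choose (p - 1) ^ (p - (q - 1)) * Nat.choose 2 2 * p.choose 0
        + ∑ i ∈ Finset.Icc 1 (q - 1),
            p.choose (q - 1 - i) * p.choose (p - 1) ^ (p - (q - 1 - i)) * Nat.choose 2 2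
              * p.choose i) ∧
    (∀ k ∈ Finset.Icc (p + 1) (2 * p - 1),
      Γ.resolvingNumber (p ^ 2 - p + 1 + k) =
        ∑ t ∈ resolvingTypes p k, resolvingTerm p t.1 t.2.1 t.2.2) := by
  subst hΓ
  have : Fact p.Prime := ⟨hp⟩
  refine ⟨metricDimension_dihedral p, ?_, ?_, ?_⟩
  · set Γ := intersectionGraph (DihedralGroup (p ^ 2))
    have hzero : Γ.resolvingNumber (p ^ 2 - p + 1 + 0) = 2 * p ^ p := by
      rw [← pendantCoeff_zero]
      exact resolvingNumber_dihedral_zero p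
    have hpen : Γ.resolvingNumber (p ^ 2 - p + 1 + 2 * p) = p ^ 2 + p + 2 := by
      have h := resolvingNumber_dihedral_succ p (2 * p - 1)
      rw [Nat.sub_add_cancel (by have := hp.pos; omega)] at h
      rw [h, pendantCoeff_two_mul, pendantCoeff_two_mul_sub_one hp.pos]
      ring
    have hlast : Γ.resolvingNumber (p ^ 2 - p + 1 + (2 * p + 1)) = 1 := by
      rw [resolvingNumber_dihedral_succ, pendantCoeff_two_mul_add_one, pendantCoeff_two_mul]
    have hlen : p ^ 2 + p + 2 + 1 - (p ^ 2 - p + 1) = 2 * p + 1 + 1 := by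
      have : p ≤ p ^ 2 := Nat.le_self_pow two_ne_zero p
      omega
    have hIcc (a b : ℕ) : Finset.Icc a b = Finset.Ico a (b + 1) := rfl
    have h2p : 2 * p - 1 + 1 = 2 * p := Nat.sub_add_cancel (by have := hp.pos; omega)
    rw [resolvingPolynomial, metricDimension_dihedral, card_subgroups_dihedral, hIcc,
      Finset.sum_Ico_eq_sum_range, hlen, Finset.sum_range_succ, Finset.sum_range_succ,
      hpen, hlast, Finset.range_eq_Ico, Finset.sum_eq_sum_Ico_succ_bot (by have := hp.pos; omega),
      hzero, choose_pred_self hp.pos, hIcc, hIcc, h2p, add_assoc (C _) (∑ _ ∈ _, _),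
      Finset.sum_Ico_consecutive _ (by omega) (by have := hp.pos; omega)]
    simp only [mul_add, Finset.mul_sum, pow_add, map_one, one_mul, Nat.choose_one_right, pow_zero]
    congr 1
    · congr 1
      · congr 1
        · ring
        · exact Finset.sum_congr rfl fun i _ => by ring
      · ring
  · intro q hq
    obtain ⟨q, rfl⟩ := Nat.exists_eq_succ_of_ne_zero
      (Nat.one_le_iff_ne_zero.1 (Finset.mem_Icc.1 hq).1)
    rw [Nat.succ_eq_add_one, resolvingNumber_dihedral_succ, pendantCoeff_eq_add_sum,
      pendantCoeff_eq_add_sum, choose_pred_self hp.pos, Nat.add_sub_cancel, mul_add,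
      Finset.mul_sum, ← add_assoc]
    simp only [Nat.choose_self, Nat.choose_one_right, mul_one]
    congr 2
    congr 1
    · ring
    · exact Finset.sum_congr rfl fun i _ => by ring
  · intro k hk
    rw [Finset.mem_Icc] at hk
    obtain ⟨k, rfl⟩ := Nat.exists_eq_succ_of_ne_zero (show k ≠ 0 by omega)
    rw [Nat.succ_eq_add_one, resolvingNumber_dihedral_succ,
      sum_resolvingTypes (by omega) (by omega)]
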